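/- Let $v$ be a $C^\infty$ function on $\mathbb R$ with $\operatorname{supp} v=[1/2,2]$ and $\sum_{j\in\mathbb Z}v(x/2^j)=1$ for all $x>0$, and put $v_j(x)=v(x/2^j)$. For $0<p<\infty$ and $s\in\mathbb R$, a locally integrable function $\varphi$ on $(0,\infty)$ belongs to the Besov class $\mathfrak B_p^s$ if $$\|\varphi\|_{\mathfrak B_p^s}=\Big(\sum_{j\in\mathbb Z}\big(2^{js}\|\mathcal F(v_j\varphi)\|_{L^p(\mathbb R)}\big)^p\Big)^{1/p}<\infty ,$$ where $\mathcal F$ is the Fourier transform. For $\alpha,\beta\in\mathbb R$ and a locally integrable function $\varphi$ on $(0,\infty)$, the weighted integral Hankel operator $\boldsymbol\Gamma_\varphi^{\alpha,\beta}$ is defined on smooth functions $f$ with compact support in $(0,\infty)$ by $$(\boldsymbol\Gamma_\varphi^{\alpha,\beta}f)(x)=\int_0^\infty x^\alpha y^\beta\varphi(x+y)f(y)\,dy,\qquad x>0.$$ We write $\boldsymbol\Gamma_\varphi^{\alpha,\beta}\in\boldsymbol S_p$ if it extends to a bounded operator $T$ on $L^2(0,\infty)$ with $\sum_{j\ge0}s_j(T)^p<\infty$,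 where $s_j(T)=\inf\{\|T-K\|:\operatorname{rank}K\le j\}$. **Theorem.** Let $\alpha,\beta\in\mathbb R$ and $0<p<\infty$, and suppose that $\min\{\alpha,\beta\}\le\max\{-\tfrac12,-\tfrac1p\}$. Then there is a (locally integrable) function $\psi\in\mathfrak B_p^{1/p+\alpha+\beta}$ on $(0,\infty)$ such that $\boldsymbol\Gamma_\psi^{\alpha,\beta}\notin\boldsymbol S_p$. -/

import Mathlib

open MeasureTheory Set
open scoped FourierTransform ContDiff

noncomputable section

namespace WeightedHankel

/-! ### Singular values and Schatten--von Neumann classes -/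

section Schatten

variable {H : Type*} [NormedAddCommGroup H] [InnerProductSpace ℂ H]

/-- The singular values `s_j(T) = inf {‖T - K‖ : rank K ≤ j}` of a bounded operator. -/
def singularValue (T : H →L[ℂ] H) (j : ℕ) : ℝ :=
  sInf {r : ℝ | ∃ K : H →L[ℂ] H, LinearMap.rank (K : H →ₗ[ℂ] H) ≤ (j : Cardinal) ∧ r = ‖T - K‖}

/-- `T ∈ S_p`: the series `∑_{j ≥ 0} s_j(T) ^ p` of nonnegative terms converges. -/
def MemSchatten (p : ℝ) (T : H →L[ℂ] H) : Prop :=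
  Summable fun j : ℕ => singularValue T j ^ p

end Schatten

/-! ### Besov classes on the half-line -/

/-- A smooth function `v` on `ℝ` with `supp v = [1/2, 2]` and
`∑_{j ∈ ℤ} v (x / 2 ^ j) = 1` for all `x > 0`. -/
structure IsDyadicCutoff (v : ℝ → ℂ) : Prop where
  contDiff : ContDiff ℝ ∞ v
  tsupport_eq : tsupport v = Icc (1 / 2) 2
  hasSum_one : ∀ x : ℝ, 0 < x → HasSum (fun j : ℤ => v (x / (2 : ℝ) ^ j)) 1

/-- The piece `v_j φ`, where `v_j x = v (x / 2 ^ j)`. For a cutoff `v` it only depends on the values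
of `φ` on `(0, ∞)`, because `v_j` vanishes on `(-∞, 0]`. -/
def dyadicPiece (v : ℝ → ℂ) (φ : ℝ → ℂ) (j : ℤ) : ℝ → ℂ :=
  fun x => v (x / (2 : ℝ) ^ j) * φ x

/-- The Besov (quasi)norm
`(∑_{j ∈ ℤ} (2 ^ (j s) * ‖𝓕 (v_j φ)‖_{L^p}) ^ p) ^ (1 / p)`, with values in `[0, ∞]`, for
`0 < p < ∞`. -/
def besovNorm (v : ℝ → ℂ) (p s : ℝ) (φ : ℝ → ℂ) : ENNReal :=
  (∑' j : ℤ, (ENNReal.ofReal ((2 : ℝ) ^ ((j : ℝ) * s)) *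
    eLpNorm (𝓕 (dyadicPiece v φ j)) (ENNReal.ofReal p) volume) ^ p) ^ (1 / p)

/-- Membership of a function on `(0, ∞)` in the Besov class of distributions with parameters
`p, s`: `φ` is locally integrable on `(0, ∞)` (so that it is a distribution there, and each
`v_j φ` is an integrable function with a classical Fourier transform) and its Besov (quasi)norm is
finite. -/
structure MemBesov (v : ℝ → ℂ) (p s : ℝ) (φ : ℝ → ℂ) : Prop where
  locallyIntegrableOn : LocallyIntegrableOn φ (Ioi 0) volume
  besovNorm_lt_top : besovNorm v p s φ < ⊤

/-! ### Weighted integral Hankel operators -/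

/-- Lebesgue measure on `(0, ∞)`. -/
abbrev volPos : Measure ℝ := volume.restrict (Ioi 0)

/-- The Hilbert space `L²(0, ∞)`. -/
abbrev L2Pos : Type := Lp ℂ 2 volPos

/-- Smooth complex functions with compact support in `(0, ∞)`. -/
abbrev TestPos : Type := TestFunction (⟨Ioi (0 : ℝ), isOpen_Ioi⟩ : TopologicalSpace.Opens ℝ) ℂ ⊤

theorem TestPos.memLp (f : TestPos) : MemLp (f : ℝ → ℂ) 2 volPos :=
  (f.continuous.memLp_of_hasCompactSupport f.hasCompactSupport).restrict _

/-- A test function as an element of `L²(0, ∞)`. -/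
def TestPos.toL2 (f : TestPos) : L2Pos := (TestPos.memLp f).toLp (f : ℝ → ℂ)

/-- `x ↦ ∫_0^∞ x ^ α * y ^ β * φ (x + y) * f y dy`, for `x > 0`. -/
def hankelIntegral (α β : ℝ) (φ f : ℝ → ℂ) (x : ℝ) : ℂ :=
  ∫ y in Ioi (0 : ℝ), ((x ^ α * y ^ β : ℝ) : ℂ) * φ (x + y) * f y

/-- The bounded operator `T` on `L²(0, ∞)` extends the weighted integral Hankel operator with
symbol `φ` and weights `α, β`, which is defined on test functions. -/
def ExtendsHankel (α β : ℝ) (φ : ℝ → ℂ) (T : L2Pos →L[ℂ] L2Pos) : Prop :=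
  ∀ f : TestPos, (T (TestPos.toL2 f) : ℝ → ℂ) =ᵐ[volPos] hankelIntegral α β φ f

/-- The weighted integral Hankel operator with symbol `φ` and weights `α, β` belongs to `S_p`: it
extends from the test functions to a bounded operator on `L²(0, ∞)` of class `S_p`. -/
def HankelMemSchatten (α β p : ℝ) (φ : ℝ → ℂ) : Prop :=
  ∃ T : L2Pos →L[ℂ] L2Pos, ExtendsHankel α β φ T ∧ MemSchatten p T

end WeightedHankel

end

/-! Two mechanisms produce the counterexamples. If one weight has exponent at most `-1/2`, a single
smooth bump at `1` suffices. It lies in every Besov class, but its kernel is constant in `x + y`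
near `1`, so the operator behaves like a rank-one operator built from `x ^ α` or `y ^ β` near `0`.
That power is not square integrable there, hence there is no bounded extension
(`not_extendsHankel_of_left`, `not_extendsHankel_of_right`). Otherwise `p ≥ 2` and one exponent is
at most `-1/p`. Take a spike of height `a` and width of order `h` near `R`. Hausdorff–Young-type
interpolation bounds the `p`-th power of its Besov norm by a multiple of `a ^ p * h ^ (p - 1) * R ^
(s * p)`, with `s = 1/p + α + β`. Cutting the antidiagonal strip `x + y ≈ R` into boxes of side `h`
at distance about `i * h` from an axis, and testing on disjoint bumps, bounds the Schatten sum below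
by the same quantity times `∑ 1 / (i + 2)` (`spike_le`). The harmonic sum diverges as the spike gets
thinner. Summing thinner and thinner spikes at `8 ^ n` with summable Besov sizes, but harmonic gains
that outweigh them, gives `ψ`. -/

noncomputable section

namespace WeightedHankel

/-! ### Schatten sums bounded below through orthonormal systems -/

section Schatten

open Module

theorem norm_sq_apply_eq_sum_singularValues {E F : Type*} [NormedAddCommGroup E]
    [InnerProductSpace ℂ E] [FiniteDimensional ℂ E] [NormedAddCommGroup F]
    [InnerProductSpace ℂ F] [FiniteDimensional ℂ F] (S : E →ₗ[ℂ] F) {n : ℕ}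
    (hn : finrank ℂ E = n) (x : E) :
    ‖S x‖ ^ 2 = ∑ j : Fin n, S.singularValues j ^ 2 *
      ‖inner ℂ (S.isSymmetric_adjoint_comp_self.eigenvectorBasis hn j) x‖ ^ 2 := by
  set hS := S.isSymmetric_adjoint_comp_self
  set u := hS.eigenvectorBasis hn
  have h1 : (inner ℂ (S x) (S x) : ℂ) = inner ℂ x ((LinearMap.adjoint S ∘ₗ S) x) := by
    rw [LinearMap.comp_apply, LinearMap.adjoint_inner_right]
  rw [← u.sum_inner_mul_inner x] at h1
  have h2 : ((‖S x‖ ^ 2 : ℝ) : ℂ) = inner ℂ (S x) (S x) := by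
    rw [inner_self_eq_norm_sq_to_K]; push_cast; rfl
  rw [h1] at h2
  have h3 : ∀ j, (inner ℂ x (u j) * inner ℂ (u j) ((LinearMap.adjoint S ∘ₗ S) x) : ℂ)
      = ((S.singularValues j ^ 2 * ‖inner ℂ (u j) x‖ ^ 2 : ℝ) : ℂ) := by
    intro j
    rw [← hS (u j) x, hS.apply_eigenvectorBasis hn j, inner_smul_left,
      S.sq_singularValues_fin hn j, ← inner_conj_symm x (u j)]
    rw [mul_left_comm, Complex.conj_mul']
    push_cast
    simp
  simp_rw [h3] at h2
  exact_mod_cast h2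

variable {H : Type*} [NormedAddCommGroup H] [InnerProductSpace ℂ H]

theorem singularValue_nonneg (T : H →L[ℂ] H) (j : ℕ) : 0 ≤ singularValue T j := by
  apply Real.sInf_nonneg
  rintro r ⟨K, -, rfl⟩
  exact norm_nonneg _

/-- The compression of an operator to a finite-dimensional subspace has singular values dominated
by the approximation numbers of the operator. -/
theorem singularValues_comp_le {E F : Type*} [NormedAddCommGroup E]
    [InnerProductSpace ℂ E] [FiniteDimensional ℂ E] [NormedAddCommGroup F]
    [InnerProductSpace ℂ F] [FiniteDimensional ℂ F] (T : H →L[ℂ] H) (V : E →ₗᵢ[ℂ] H)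
    (S : E →ₗ[ℂ] F) (hS : ∀ x, ‖S x‖ = ‖T (V x)‖) {n : ℕ} (hn : finrank ℂ E = n) (j : Fin n) :
    S.singularValues j ≤ singularValue T j := by
  apply le_csInf
  · exact ⟨‖T - 0‖, 0, by simp, rfl⟩
  rintro r ⟨K, hK, rfl⟩
  set u := S.isSymmetric_adjoint_comp_self.eigenvectorBasis hn
  let g : (Fin (j + 1) → ℂ) →ₗ[ℂ] E :=
    Fintype.linearCombination ℂ (fun i : Fin (j + 1) => u (Fin.castLE j.2 i))
  have hui : LinearIndependent ℂ (fun i : Fin (j + 1) => u (Fin.castLE j.2 i)) :=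
    u.orthonormal.linearIndependent.comp _ (Fin.castLE_injective j.2)
  let f : (Fin (j + 1) → ℂ) →ₗ[ℂ] H := (K : H →ₗ[ℂ] H) ∘ₗ V.toLinearMap ∘ₗ g
  have hrank : LinearMap.rank f ≤ (j : ℕ) := (LinearMap.rank_comp_le_left _ _).trans hK
  -- Dimension count: the top `j + 1` right singular vectors span a space too large for `K`, of rank
  -- at most `j`, to be injective on it. On the resulting kernel vector `T` agrees with `T - K`,
  -- while `S` stretches by at least its `j`-th singular value.
  obtain ⟨c, hc, hc0⟩ : ∃ c, f c = 0 ∧ c ≠ 0 := by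
    by_contra! h
    have hinj : Function.Injective f := (injective_iff_map_eq_zero f).2 h
    have h1 := lift_rank_range_of_injective f hinj
    have h2 := Cardinal.lift_le.{0}.2 hrank
    rw [LinearMap.rank, h1, rank_fun'] at h2
    simp only [Fintype.card_fin, Cardinal.lift_natCast, Nat.cast_le] at h2
    omega
  set x := g c with hx
  have hx0 : x ≠ 0 := by
    intro h
    apply hc0
    have : Function.Injective g := hui.fintypeLinearCombination_injective
    exact this (by rw [map_zero]; exact h)
  have hinner : ∀ k : Fin n, j < k → inner ℂ (u k) x = 0 := by
    intro k hk
    rw [hx, Fintype.linearCombination_apply, inner_sum]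
    refine Finset.sum_eq_zero fun i _ => ?_
    rw [inner_smul_right, u.inner_eq_zero, mul_zero]
    intro h
    have := congrArg Fin.val h
    have h2 : (j : ℕ) < k := hk
    simp at this
    omega
  have hlow : (S.singularValues j * ‖x‖) ^ 2 ≤ ‖S x‖ ^ 2 := by
    rw [norm_sq_apply_eq_sum_singularValues S hn x, mul_pow, ← u.sum_sq_norm_inner_right x,
      Finset.mul_sum]
    refine Finset.sum_le_sum fun k _ => ?_
    rcases lt_or_ge j k with h | h
    · rw [hinner k h]; simp
    · gcongr
      · exact S.singularValues_nonneg _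
      · exact S.singularValues_antitone h
  have hlow' : S.singularValues j * ‖x‖ ≤ ‖S x‖ :=
    le_of_sq_le_sq hlow (norm_nonneg _)
  have hup : ‖S x‖ ≤ ‖T - K‖ * ‖x‖ := by
    have : T (V x) = (T - K) (V x) := by
      have : K (V x) = 0 := hc
      simp [this]
    rw [hS, this]
    calc _ ≤ ‖T - K‖ * ‖V x‖ := (T - K).le_opNorm _
      _ = _ := by rw [V.norm_map]
  exact le_of_mul_le_mul_right (hlow'.trans hup) (norm_pos_iff.2 hx0)

/-- Each `‖T (e i)‖ ^ 2` is an average of squared singular values of the compression, with weights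
forming a doubly stochastic matrix. Jensen for the convex function `t ^ (p / 2)` (here `p ≥ 2`
enters) and summation over `i` remove the weights. -/
theorem sum_norm_rpow_le_tsum_singularValue {p : ℝ} (hp : 2 ≤ p) (T : H →L[ℂ] H)
    (hT : MemSchatten p T) {n : ℕ} {e : Fin n → H} (he : Orthonormal ℂ e) :
    ∑ i, ‖T (e i)‖ ^ p ≤ ∑' j, singularValue T j ^ p := by
  obtain ⟨b, V, hV⟩ : ∃ (b : OrthonormalBasis (Fin n) ℂ (EuclideanSpace ℂ (Fin n)))
      (V : EuclideanSpace ℂ (Fin n) →ₗᵢ[ℂ] H), ∀ i, V (b i) = e i := by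
    let b := EuclideanSpace.basisFun (Fin n) ℂ
    have hc : (⇑(b.toBasis.constr ℂ e) ∘ ⇑b.toBasis) = e := by
      ext i; simp only [Function.comp, Basis.constr_basis]
    refine ⟨b, (b.toBasis.constr ℂ e).isometryOfOrthonormal (v := b.toBasis)
      (by rw [b.coe_toBasis]; exact b.orthonormal) (by rwa [hc]), fun i => ?_⟩
    exact congrFun hc i
  -- Restricting the codomain to the range makes both spaces finite-dimensional without changing
  -- norms.
  let S := ((T : H →ₗ[ℂ] H) ∘ₗ V.toLinearMap).rangeRestrict
  have hS : ∀ x, ‖S x‖ = ‖T (V x)‖ := fun x => rfl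
  have hn : finrank ℂ (EuclideanSpace ℂ (Fin n)) = n := by simp
  set u := S.isSymmetric_adjoint_comp_self.eigenvectorBasis hn
  have h1 : ∀ i, ‖T (e i)‖ ^ p ≤ ∑ j : Fin n, ‖inner ℂ (u j) (b i)‖ ^ 2 *
      S.singularValues j ^ p := by
    intro i
    have hw : ∑ j : Fin n, ‖inner ℂ (u j) (b i)‖ ^ 2 = 1 := by
      rw [u.sum_sq_norm_inner_right, b.norm_eq_one]; simp
    have hJ := Real.rpow_arith_mean_le_arith_mean_rpow Finset.univ
      (fun j : Fin n => ‖inner ℂ (u j) (b i)‖ ^ 2) (fun j => S.singularValues j ^ 2)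
      (fun j _ => by positivity) hw (fun j _ => by positivity) (p := p / 2) (by linarith)
    have e1 : ∀ r : ℝ, 0 ≤ r → (r ^ 2) ^ (p / 2) = r ^ p := by
      intro r hr
      rw [← Real.rpow_natCast, ← Real.rpow_mul hr]
      congr 1; push_cast; ring
    rw [← hV, ← hS, ← e1 _ (norm_nonneg _), norm_sq_apply_eq_sum_singularValues S hn]
    simp_rw [e1 _ (S.singularValues_nonneg _)] at hJ
    simp_rw [mul_comm (S.singularValues _ ^ 2)]
    exact hJ
  have h2 : ∀ j, ∑ i, ‖inner ℂ (u j) (b i)‖ ^ 2 = 1 := by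
    intro j
    rw [b.sum_sq_norm_inner_left, u.norm_eq_one]; simp
  calc ∑ i, ‖T (e i)‖ ^ p ≤ ∑ i, ∑ j : Fin n, ‖inner ℂ (u j) (b i)‖ ^ 2 *
        S.singularValues j ^ p := Finset.sum_le_sum fun i _ => h1 i
    _ = ∑ j : Fin n, S.singularValues j ^ p := by
        rw [Finset.sum_comm]
        refine Finset.sum_congr rfl fun j _ => ?_
        rw [← Finset.sum_mul, h2, one_mul]
    _ ≤ ∑ j : Fin n, singularValue T j ^ p := by
        refine Finset.sum_le_sum fun j _ => ?_
        exact Real.rpow_le_rpow (S.singularValues_nonneg _) (singularValues_comp_le T V S hS hn j)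
          (by linarith)
    _ = ∑ j ∈ Finset.range n, singularValue T j ^ p := by
        rw [Finset.sum_range]
    _ ≤ _ := hT.sum_le_tsum _ fun j _ => Real.rpow_nonneg (singularValue_nonneg T j) _

end Schatten

/-! ### Besov norms of bumps and of lacunary sums of bumps -/

section Besov

theorem eLpNorm_rpow_eq_lintegral {p : ℝ} (hp : 0 < p) (f : ℝ → ℂ) :
    eLpNorm f (ENNReal.ofReal p) volume ^ p = ∫⁻ x, ‖f x‖ₑ ^ p := by
  rw [eLpNorm_eq_lintegral_rpow_enorm_toReal (by simpa using hp) ENNReal.ofReal_ne_top,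
    ENNReal.toReal_ofReal hp.le, ← ENNReal.rpow_mul, one_div, inv_mul_cancel₀ hp.ne',
    ENNReal.rpow_one]

/-- Interpolation between the trivial bound for the Fourier transform and Plancherel's theorem. -/
theorem lintegral_fourier_rpow_le {p : ℝ} (hp : 2 ≤ p) {f : ℝ → ℂ} (hf : ContDiff ℝ ∞ f)
    (hc : HasCompactSupport f) :
    ∫⁻ ξ, ‖𝓕 f ξ‖ₑ ^ p ≤ ENNReal.ofReal ((∫ x, ‖f x‖) ^ (p - 2) * ∫ x, ‖f x‖ ^ 2) := by
  let g : SchwartzMap ℝ ℂ := hc.toSchwartzMap hf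
  have hg : (g : ℝ → ℂ) = f := rfl
  have hF : 𝓕 f = (𝓕 g : SchwartzMap ℝ ℂ) := by rw [SchwartzMap.fourier_coe, hg]
  set A := ∫ x, ‖f x‖
  have hA : 0 ≤ A := integral_nonneg fun _ => norm_nonneg _
  have hsup : ∀ ξ, ‖𝓕 f ξ‖ ≤ A := by
    intro ξ
    rw [Real.fourier_eq]
    refine (norm_integral_le_integral_norm _).trans_eq ?_
    simp [A]
  have hint : Integrable (fun ξ => ‖𝓕 f ξ‖ ^ 2) := by
    rw [hF]
    exact ((𝓕 g).memLp 2 volume).integrable_norm_pow (by norm_num)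
  have hpl : ∫ ξ, ‖𝓕 f ξ‖ ^ 2 = ∫ x, ‖f x‖ ^ 2 := by
    rw [hF, ← hg]
    exact SchwartzMap.integral_norm_sq_fourier g
  rw [← hpl, ← integral_const_mul, ofReal_integral_eq_lintegral_ofReal (hint.const_mul _)
    (Filter.Eventually.of_forall fun ξ => by positivity)]
  refine lintegral_mono fun ξ => ?_
  rw [← ofReal_norm, ENNReal.ofReal_rpow_of_nonneg (norm_nonneg _) (by linarith)]
  apply ENNReal.ofReal_le_ofReal
  calc ‖𝓕 f ξ‖ ^ p = ‖𝓕 f ξ‖ ^ ((p - 2) + (2 : ℕ)) := by congr 1; push_cast; ring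
    _ = ‖𝓕 f ξ‖ ^ (p - 2) * ‖𝓕 f ξ‖ ^ 2 := by
        rw [Real.rpow_add_of_nonneg (norm_nonneg _) (by linarith) (by positivity),
          Real.rpow_natCast]
    _ ≤ _ := by
        gcongr
        exact hsup ξ

/-- Only height and width enter, not derivatives, so the estimate is uniform over arbitrarily thin
spikes. -/
theorem lintegral_fourier_rpow_le_of_bounded {p : ℝ} (hp : 2 ≤ p) {f : ℝ → ℂ}
    (hf : ContDiff ℝ ∞ f) {c h a : ℝ} (hh : 0 ≤ h) (ha : 0 ≤ a) (hfa : ∀ x, ‖f x‖ ≤ a)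
    (hs : Function.support f ⊆ Metric.ball c h) :
    ∫⁻ ξ, ‖𝓕 f ξ‖ₑ ^ p ≤ ENNReal.ofReal (a ^ p * (2 * h) ^ (p - 1)) := by
  have hs' : Function.support f ⊆ Icc (c - h) (c + h) := by
    rw [← Real.closedBall_eq_Icc]; exact hs.trans Metric.ball_subset_closedBall
  have hc : HasCompactSupport f := HasCompactSupport.of_support_subset_isCompact isCompact_Icc hs'
  have key : ∀ k : ℕ, k ≠ 0 → ∫ x, ‖f x‖ ^ k ≤ a ^ k * (2 * h) := by
    intro k hk
    rw [← setIntegral_eq_integral_of_forall_compl_eq_zero (s := Icc (c - h) (c + h))]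
    · calc ∫ x in Icc (c - h) (c + h), ‖f x‖ ^ k ≤ ∫ x in Icc (c - h) (c + h), a ^ k := by
            apply integral_mono
            · exact (hf.continuous.norm.pow k).integrableOn_Icc
            · exact continuous_const.integrableOn_Icc
            · intro x
              exact pow_le_pow_left₀ (norm_nonneg _) (hfa x) k
        _ = a ^ k * (2 * h) := by
            rw [setIntegral_const, smul_eq_mul, Real.volume_real_Icc_of_le (by linarith)]
            ring
    · intro x hx
      have : f x = 0 := by
        by_contra h0
        exact hx (hs' h0)
      simp [this, hk]
  refine (lintegral_fourier_rpow_le hp hf hc).trans (ENNReal.ofReal_le_ofReal ?_)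
  have h1 := key 1 one_ne_zero
  simp only [pow_one] at h1
  calc (∫ x, ‖f x‖) ^ (p - 2) * ∫ x, ‖f x‖ ^ 2
      ≤ (a * (2 * h)) ^ (p - 2) * (a ^ 2 * (2 * h)) := by
        gcongr
        exact key 2 two_ne_zero
    _ = (a ^ (p - 2) * a ^ (2 : ℕ)) * ((2 * h) ^ (p - 2) * (2 * h) ^ (1 : ℕ)) := by
        rw [Real.mul_rpow ha (by linarith)]; ring
    _ = _ := by
        rw [← Real.rpow_natCast, ← Real.rpow_natCast,
          ← Real.rpow_add_of_nonneg ha (by linarith) (by positivity),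
          ← Real.rpow_add_of_nonneg (by linarith) (by linarith) (by positivity)]
        congr 2 <;> push_cast <;> ring

variable {v : ℝ → ℂ}

theorem IsDyadicCutoff.mem_Icc (hv : IsDyadicCutoff v) {x : ℝ} (hx : v x ≠ 0) :
    x ∈ Icc (1 / 2 : ℝ) 2 := by
  rw [← hv.tsupport_eq]; exact subset_tsupport v hx

theorem IsDyadicCutoff.exists_bound (hv : IsDyadicCutoff v) : ∃ C, 0 ≤ C ∧ ∀ x, ‖v x‖ ≤ C := by
  have hc : HasCompactSupport v := by
    rw [HasCompactSupport, hv.tsupport_eq]; exact isCompact_Icc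
  obtain ⟨C, hC⟩ := hv.contDiff.continuous.bounded_above_of_compact_support hc
  exact ⟨C, (norm_nonneg _).trans (hC 0), hC⟩

theorem IsDyadicCutoff.contDiff_dyadicPiece (hv : IsDyadicCutoff v) {φ : ℝ → ℂ}
    (hφ : ContDiff ℝ ∞ φ) (j : ℤ) : ContDiff ℝ ∞ (dyadicPiece v φ j) :=
  (hv.contDiff.comp (contDiff_id.div_const _)).mul hφ

/-- If `2 ^ k / 2 < x < 2 ^ k * 2`, then `v_j x ≠ 0` only for `|j - k| ≤ 1`. -/
theorem IsDyadicCutoff.mem_Icc_index (hv : IsDyadicCutoff v) {x : ℝ} {j k : ℤ}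
    (hx : x ∈ Ioo ((2 : ℝ) ^ k / 2) ((2 : ℝ) ^ k * 2)) (h : v (x / (2 : ℝ) ^ j) ≠ 0) :
    j ∈ Finset.Icc (k - 1) (k + 1) := by
  obtain ⟨h1, h2⟩ := hv.mem_Icc h
  obtain ⟨h3, h4⟩ := hx
  have hj : (0 : ℝ) < 2 ^ j := by positivity
  rw [le_div_iff₀ hj] at h1
  rw [div_le_iff₀ hj] at h2
  have e1 : (2 : ℝ) ^ (j - 1) < 2 ^ (k + 1) := by
    rw [zpow_sub_one₀ two_ne_zero, zpow_add_one₀ two_ne_zero]; linarith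
  have e2 : (2 : ℝ) ^ (k - 1) < 2 ^ (j + 1) := by
    rw [zpow_sub_one₀ two_ne_zero, zpow_add_one₀ two_ne_zero]; linarith
  rw [zpow_lt_zpow_iff_right₀ one_lt_two] at e1 e2
  rw [Finset.mem_Icc]; omega

theorem IsDyadicCutoff.dyadicPiece_eq_zero (hv : IsDyadicCutoff v) {φ : ℝ → ℂ} {k : ℤ}
    (hφ : Function.support φ ⊆ Ioo ((2 : ℝ) ^ k / 2) ((2 : ℝ) ^ k * 2)) {j : ℤ}
    (hj : j ∉ Finset.Icc (k - 1) (k + 1)) : dyadicPiece v φ j = 0 := by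
  ext x
  by_contra h
  have h' := mul_ne_zero_iff.1 h
  exact hj (hv.mem_Icc_index (hφ h'.2) h'.1)

theorem fourier_zero_fun : 𝓕 (0 : ℝ → ℂ) = 0 := by
  ext ξ; simp [Real.fourier_eq]

/-- The `p`-th power of the `j`-th term of the Besov quasinorm. -/
def besovTerm (v : ℝ → ℂ) (p s : ℝ) (φ : ℝ → ℂ) (j : ℤ) : ENNReal :=
  (ENNReal.ofReal ((2 : ℝ) ^ ((j : ℝ) * s)) *
    eLpNorm (𝓕 (dyadicPiece v φ j)) (ENNReal.ofReal p) volume) ^ p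

theorem besovTerm_eq_zero {p : ℝ} (hp : 0 < p) (s : ℝ) {φ : ℝ → ℂ} {j : ℤ}
    (h : dyadicPiece v φ j = 0) : besovTerm v p s φ j = 0 := by
  rw [besovTerm, h, fourier_zero_fun, eLpNorm_zero, mul_zero, ENNReal.zero_rpow_of_pos hp]

theorem besovNorm_lt_top_of_tsum {p : ℝ} (hp : 0 < p) {s : ℝ} {φ : ℝ → ℂ}
    (h : ∑' j, besovTerm v p s φ j ≠ ⊤) : besovNorm v p s φ < ⊤ :=
  ENNReal.rpow_lt_top_of_nonneg (by positivity) h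

/-- At most three dyadic pieces survive, and each has a Schwartz Fourier transform, which lies in
`L^p` even for `p < 1`. -/
theorem IsDyadicCutoff.memBesov_of_contDiff (hv : IsDyadicCutoff v) {p : ℝ} (hp : 0 < p) (s : ℝ)
    {φ : ℝ → ℂ} (hφ : ContDiff ℝ ∞ φ) (hc : HasCompactSupport φ) {k : ℤ}
    (hs : Function.support φ ⊆ Ioo ((2 : ℝ) ^ k / 2) ((2 : ℝ) ^ k * 2)) : MemBesov v p s φ := by
  refine ⟨hφ.continuous.locallyIntegrable.locallyIntegrableOn _, besovNorm_lt_top_of_tsum hp ?_⟩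
  rw [tsum_eq_sum fun j hj => besovTerm_eq_zero hp s (hv.dyadicPiece_eq_zero hs hj)]
  refine ENNReal.sum_ne_top.2 fun j _ => ENNReal.rpow_ne_top_of_nonneg hp.le
    (ENNReal.mul_ne_top ENNReal.ofReal_ne_top ?_)
  let g : SchwartzMap ℝ ℂ :=
    (hc.mul_left (f := fun x => v (x / (2 : ℝ) ^ j))).toSchwartzMap (hv.contDiff_dyadicPiece hφ j)
  exact ((𝓕 g).memLp (ENNReal.ofReal p) volume).2.ne

/-- The Besov terms of a function concentrated near `2 ^ k`. -/
theorem IsDyadicCutoff.tsum_besovTerm_le (hv : IsDyadicCutoff v) {p : ℝ} (hp : 2 ≤ p) (s : ℝ) :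
    ∃ C, 0 ≤ C ∧ ∀ (φ : ℝ → ℂ) (k : ℤ) (c h a : ℝ), ContDiff ℝ ∞ φ → 0 ≤ h → 0 ≤ a →
      (∀ x, ‖φ x‖ ≤ a) → Function.support φ ⊆ Metric.ball c h →
      Function.support φ ⊆ Ioo ((2 : ℝ) ^ k / 2) ((2 : ℝ) ^ k * 2) →
      ∑' j, besovTerm v p s φ j
        ≤ ENNReal.ofReal (C * (a ^ p * h ^ (p - 1) * (2 : ℝ) ^ ((k : ℝ) * s * p))) := by
  obtain ⟨B, hB0, hB⟩ := hv.exists_bound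
  -- Three pieces meet the support; `2 ^ (|s| * p)` pays for `|j - k| ≤ 1`, `B ^ p` for the cutoff,
  -- and `2 ^ (p - 1)` for the support length `2 * h`.
  refine ⟨3 * ((2 : ℝ) ^ (|s| * p) * B ^ p * 2 ^ (p - 1)), by positivity, ?_⟩
  intro φ k c h a hφ hh ha hφa hsb hsk
  have hp0 : 0 < p := by linarith
  rw [tsum_eq_sum fun j hj => besovTerm_eq_zero hp0 s (hv.dyadicPiece_eq_zero hsk hj)]
  set D := (2 : ℝ) ^ (|s| * p) * B ^ p * 2 ^ (p - 1) *
    (a ^ p * h ^ (p - 1) * (2 : ℝ) ^ ((k : ℝ) * s * p)) with hD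
  have hterm : ∀ j ∈ Finset.Icc (k - 1) (k + 1), besovTerm v p s φ j ≤ ENNReal.ofReal D := by
    intro j hj
    rw [Finset.mem_Icc] at hj
    rw [besovTerm, ENNReal.mul_rpow_of_nonneg _ _ hp0.le, eLpNorm_rpow_eq_lintegral hp0,
      ENNReal.ofReal_rpow_of_nonneg (by positivity) hp0.le]
    have h1 := lintegral_fourier_rpow_le_of_bounded hp (hv.contDiff_dyadicPiece hφ j) (c := c)
      (a := B * a) hh (by positivity)
      (fun x => by
        rw [dyadicPiece, norm_mul]
        exact mul_le_mul (hB _) (hφa x) (norm_nonneg _) hB0)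
      (fun x hx => hsb (mul_ne_zero_iff.1 hx).2)
    refine (mul_le_mul_right h1 _).trans ?_
    rw [← ENNReal.ofReal_mul (by positivity)]
    apply ENNReal.ofReal_le_ofReal
    have h2 : ((2 : ℝ) ^ ((j : ℝ) * s)) ^ p ≤ (2 : ℝ) ^ (|s| * p) * (2 : ℝ) ^ ((k : ℝ) * s * p) := by
      rw [← Real.rpow_mul zero_le_two, ← Real.rpow_add two_pos]
      apply Real.rpow_le_rpow_of_exponent_le one_le_two
      have h3 : ((j : ℝ) - k) * s ≤ |s| := by
        have : |(j : ℝ) - k| ≤ 1 := by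
          rw [abs_le]
          constructor
          · have : ((k - 1 : ℤ) : ℝ) ≤ j := by exact_mod_cast hj.1
            push_cast at this; linarith
          · have : (j : ℝ) ≤ ((k + 1 : ℤ) : ℝ) := by exact_mod_cast hj.2
            push_cast at this; linarith
        calc ((j : ℝ) - k) * s ≤ |((j : ℝ) - k) * s| := le_abs_self _
          _ = |(j : ℝ) - k| * |s| := abs_mul _ _
          _ ≤ 1 * |s| := by gcongr
          _ = |s| := one_mul _
      nlinarith [mul_le_mul_of_nonneg_right h3 hp0.le]
    calc ((2 : ℝ) ^ ((j : ℝ) * s)) ^ p * ((B * a) ^ p * (2 * h) ^ (p - 1))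
        ≤ ((2 : ℝ) ^ (|s| * p) * (2 : ℝ) ^ ((k : ℝ) * s * p)) *
          ((B * a) ^ p * (2 * h) ^ (p - 1)) := by gcongr
      _ = D := by
        rw [Real.mul_rpow hB0 ha, Real.mul_rpow zero_le_two hh, hD]; ring
  calc _ ≤ ∑ j ∈ Finset.Icc (k - 1) (k + 1), ENNReal.ofReal D := Finset.sum_le_sum hterm
    _ = ENNReal.ofReal (3 * D) := by
        rw [Finset.sum_const, Int.card_Icc, nsmul_eq_mul, ENNReal.ofReal_mul zero_le_three,
          show k + 1 + 1 - (k - 1) = 3 by ring, ENNReal.ofReal_ofNat]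
        rfl
    _ = _ := by rw [hD]; congr 1; ring

theorem locallyFinite_of_subset_Ioo {S : ℕ → Set ℝ}
    (hS : ∀ n, S n ⊆ Ioo ((8 : ℝ) ^ n / 2) ((8 : ℝ) ^ n * 2)) : LocallyFinite S := by
  intro x
  refine ⟨Metric.ball x 1, Metric.ball_mem_nhds x one_pos, ?_⟩
  obtain ⟨N, hN⟩ := exists_nat_gt (2 * (x + 1))
  refine (Set.finite_Iio N).subset ?_
  rintro n ⟨y, hy, hyx⟩
  have h1 := (hS n hy).1
  rw [Metric.mem_ball, Real.dist_eq, abs_lt] at hyx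
  have h2 : (n : ℝ) < 8 ^ n := by exact_mod_cast Nat.lt_pow_self (by norm_num)
  have : (n : ℝ) < N := by linarith
  exact_mod_cast this

/-- Membership in the Besov class of a sum of functions concentrated near the points `8 ^ n`. -/
theorem IsDyadicCutoff.memBesov_finsum (hv : IsDyadicCutoff v) {p : ℝ} (hp : 2 ≤ p) (s : ℝ)
    (φ : ℕ → ℝ → ℂ) (c h a b : ℕ → ℝ) (hφ : ∀ n, ContDiff ℝ ∞ (φ n)) (hh : ∀ n, 0 ≤ h n)
    (ha : ∀ n, 0 ≤ a n) (hφa : ∀ n x, ‖φ n x‖ ≤ a n)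
    (hsb : ∀ n, Function.support (φ n) ⊆ Metric.ball (c n) (h n))
    (hsk : ∀ n, Function.support (φ n) ⊆ Ioo ((8 : ℝ) ^ n / 2) ((8 : ℝ) ^ n * 2))
    (hb : Summable b)
    (hab : ∀ n, a n ^ p * h n ^ (p - 1) * ((8 : ℝ) ^ n) ^ (s * p) ≤ b n) :
    MemBesov v p s (fun x => ∑ᶠ n, φ n x) := by
  have hp0 : 0 < p := by linarith
  have h8 : ∀ n : ℕ, (8 : ℝ) ^ n = (2 : ℝ) ^ (3 * n : ℤ) := by
    intro n; rw [zpow_mul]; norm_num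
  have hlf := locallyFinite_of_subset_Ioo hsk
  refine ⟨(continuous_finsum (fun n => (hφ n).continuous)
    hlf).locallyIntegrable.locallyIntegrableOn _, besovNorm_lt_top_of_tsum hp0 ?_⟩
  -- Since `8 = 2 ^ 3`, the index ranges `3n - 1, 3n, 3n + 1` are disjoint, so a dyadic piece sees
  -- at most one spike. For negative `j` the truncation by `toNat` is harmless: no spike with `n >
  -- 0` is seen.
  have hpiece : ∀ j : ℤ, ∃ n, dyadicPiece v (fun x => ∑ᶠ n, φ n x) j = dyadicPiece v (φ n) j := by
    intro j
    refine ⟨((j + 1) / 3).toNat, ?_⟩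
    ext x
    by_cases hx : v (x / (2 : ℝ) ^ j) = 0
    · simp [dyadicPiece, hx]
    · simp only [dyadicPiece]
      congr 1
      apply finsum_eq_single
      intro m hm
      by_contra h0
      have h1 := hsk m h0
      rw [h8] at h1
      have h2 := hv.mem_Icc_index h1 hx
      rw [Finset.mem_Icc] at h2
      omega
  obtain ⟨C, hC0, hC⟩ := hv.tsum_besovTerm_le hp s
  have hle : ∑' j, besovTerm v p s (fun x => ∑ᶠ n, φ n x) j
      ≤ ∑' n, ENNReal.ofReal (C * b n) := by
    calc _ ≤ ∑' j, ∑' n, besovTerm v p s (φ n) j := by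
          refine ENNReal.tsum_le_tsum fun j => ?_
          obtain ⟨n, hn⟩ := hpiece j
          refine le_trans (le_of_eq ?_) (ENNReal.le_tsum n)
          rw [besovTerm, hn, besovTerm]
      _ = ∑' n, ∑' j, besovTerm v p s (φ n) j := ENNReal.tsum_comm
      _ ≤ _ := by
          refine ENNReal.tsum_le_tsum fun n => ?_
          refine (hC (φ n) (3 * n) (c n) (h n) (a n) (hφ n) (hh n) (ha n) (hφa n) (hsb n)
            (by rw [← h8]; exact hsk n)).trans (ENNReal.ofReal_le_ofReal ?_)
          gcongr
          refine le_trans (le_of_eq ?_) (hab n)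
          rw [h8, ← Real.rpow_intCast, ← Real.rpow_mul zero_le_two, mul_assoc _ s p]
  exact ne_top_of_le_ne_top (hb.mul_left C).tsum_ofReal_ne_top hle

end Besov

/-! ### Testing a Hankel operator on localized bumps -/

section Hankel

theorem norm_sq_eq_integral_of_ae_eq (F : L2Pos) {f : ℝ → ℂ} (h : (F : ℝ → ℂ) =ᵐ[volPos] f) :
    ‖F‖ ^ 2 = ∫ x in Ioi (0 : ℝ), ‖f x‖ ^ 2 := by
  have h1 : (inner ℂ F F : ℂ) = ((∫ x in Ioi (0 : ℝ), ‖f x‖ ^ 2 : ℝ) : ℂ) := by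
    rw [L2.inner_def, ← integral_complex_ofReal]
    refine integral_congr_ae ?_
    filter_upwards [h] with x hx
    rw [inner_self_eq_norm_sq_to_K, hx]; push_cast; rfl
  rw [inner_self_eq_norm_sq_to_K] at h1
  exact Complex.ofReal_injective (by rw [Complex.ofReal_pow]; exact h1)

theorem TestPos.norm_toL2_sq (f : TestPos) :
    ‖TestPos.toL2 f‖ ^ 2 = ∫ x in Ioi (0 : ℝ), ‖f x‖ ^ 2 :=
  norm_sq_eq_integral_of_ae_eq _ (TestPos.memLp f).coeFn_toLp

variable {α β : ℝ} {φ : ℝ → ℂ} {T : L2Pos →L[ℂ] L2Pos}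

theorem ExtendsHankel.integrableOn_norm_sq (hT : ExtendsHankel α β φ T) (f : TestPos) :
    IntegrableOn (fun x => ‖hankelIntegral α β φ f x‖ ^ 2) (Ioi 0) :=
  MemLp.integrable_norm_pow ((memLp_congr_ae (hT f)).1 (Lp.memLp _)) two_ne_zero

theorem ExtendsHankel.norm_apply_sq (hT : ExtendsHankel α β φ T) (f : TestPos) :
    ‖T (TestPos.toL2 f)‖ ^ 2 = ∫ x in Ioi (0 : ℝ), ‖hankelIntegral α β φ f x‖ ^ 2 :=
  norm_sq_eq_integral_of_ae_eq _ (hT f)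

theorem ExtendsHankel.sq_mul_le (hT : ExtendsHankel α β φ T) (f : TestPos) {l r m : ℝ}
    (hl : 0 < l) (hlr : l ≤ r) (hm : 0 ≤ m)
    (h : ∀ x ∈ Icc l r, m ≤ ‖hankelIntegral α β φ f x‖) :
    m ^ 2 * (r - l) ≤ ‖T (TestPos.toL2 f)‖ ^ 2 := by
  rw [hT.norm_apply_sq]
  have hsub : Icc l r ⊆ Ioi 0 := fun x hx => hl.trans_le hx.1
  calc m ^ 2 * (r - l) = ∫ x in Icc l r, m ^ 2 := by
        rw [setIntegral_const, smul_eq_mul, Real.volume_real_Icc_of_le hlr]; ring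
    _ ≤ ∫ x in Icc l r, ‖hankelIntegral α β φ f x‖ ^ 2 := by
        refine setIntegral_mono_on continuous_const.integrableOn_Icc
          ((hT.integrableOn_norm_sq f).mono_set hsub) measurableSet_Icc fun x hx => ?_
        exact pow_le_pow_left₀ hm (h x hx) 2
    _ ≤ _ := setIntegral_mono_set (hT.integrableOn_norm_sq f)
        (Filter.Eventually.of_forall fun x => by positivity) hsub.eventuallyLE

/-- A real smooth function with compact support in `(0, ∞)` as a test function. -/
def testOfReal (g : ℝ → ℝ) (hg : ContDiff ℝ ∞ g) (hc : HasCompactSupport g)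
    (hs : tsupport g ⊆ Ioi 0) : TestPos where
  toFun := fun x => (g x : ℂ)
  contDiff' := Complex.ofRealCLM.contDiff.comp hg
  hasCompactSupport' := hc.comp_left (g := fun r : ℝ => (r : ℂ)) Complex.ofReal_zero
  tsupport_subset' := (tsupport_comp_subset (g := fun r : ℝ => (r : ℂ))
    Complex.ofReal_zero g).trans hs

theorem testOfReal_apply {g : ℝ → ℝ} (hg : ContDiff ℝ ∞ g) (hc : HasCompactSupport g)
    (hs : tsupport g ⊆ Ioi 0) (x : ℝ) : testOfReal g hg hc hs x = (g x : ℂ) := rfl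

theorem contDiff_rpow_mul (β : ℝ) {g : ℝ → ℝ} (hg : ContDiff ℝ ∞ g) (hs : tsupport g ⊆ Ioi 0) :
    ContDiff ℝ ∞ (fun y => y ^ β * g y) := by
  rw [contDiff_iff_contDiffAt]
  intro y
  by_cases hy : y ∈ tsupport g
  · exact (Real.contDiffAt_rpow_const_of_ne (ne_of_gt (hs hy))).mul hg.contDiffAt
  · have h : (fun y => y ^ β * g y) =ᶠ[nhds y] fun _ => 0 := by
      filter_upwards [notMem_tsupport_iff_eventuallyEq.1 hy] with z hz
      rw [hz]; simp
    exact contDiffAt_const.congr_of_eventuallyEq h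

theorem integrable_symbol_mul {k g : ℝ → ℝ} (hk : Continuous k) (hg : ContDiff ℝ ∞ g)
    (hc : HasCompactSupport g) (hs : tsupport g ⊆ Ioi 0) (β x : ℝ) :
    Integrable (fun y => k (x + y) * (y ^ β * g y)) := by
  apply Continuous.integrable_of_hasCompactSupport
  · exact (hk.comp (continuous_const.add continuous_id)).mul (contDiff_rpow_mul β hg hs).continuous
  · exact (hc.mul_left (f := fun y => y ^ β)).mul_left

theorem hankelIntegral_ofReal (α β : ℝ) (k g : ℝ → ℝ) (x : ℝ) :
    hankelIntegral α β (fun x => (k x : ℂ)) (fun x => (g x : ℂ)) x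
      = ((x ^ α * ∫ y in Ioi (0 : ℝ), k (x + y) * (y ^ β * g y) : ℝ) : ℂ) := by
  rw [hankelIntegral, ← integral_const_mul, ← integral_complex_ofReal]
  congr 1
  ext y
  push_cast
  ring

/-- Lower bound for the norm of a Hankel operator on a bump at `c`, tested near `d`. -/
theorem ExtendsHankel.mul_norm_le_of_bump {k : ℝ → ℝ} (hk : Continuous k)
    (hT : ExtendsHankel α β (fun x => (k x : ℂ)) T)
    {c d h a u w : ℝ} (ha : 0 ≤ a) (hu : 0 ≤ u) (hw : 0 ≤ w)
    (χ : ContDiffBump c) (hin : χ.rIn = h / 4) (hout : χ.rOut = h / 2) (hs : tsupport χ ⊆ Ioi 0)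
    (hd : h / 2 < d) (hka : ∀ x, |x - (c + d)| ≤ h → a ≤ k x)
    (hyβ : ∀ y, |y - c| ≤ h / 2 → w ≤ y ^ β) (hxα : ∀ x, |x - d| ≤ h / 2 → u ≤ x ^ α) :
    u * w * a * (h / 2) * ‖TestPos.toL2 (testOfReal χ χ.contDiff χ.hasCompactSupport hs)‖
      ≤ ‖T (TestPos.toL2 (testOfReal χ χ.contDiff χ.hasCompactSupport hs))‖ := by
  have hh : 0 < h := by have := χ.rIn_pos; linarith
  set e := testOfReal χ χ.contDiff χ.hasCompactSupport hs
  have hball : Metric.closedBall c (h / 2) ⊆ Ioi 0 := by rwa [← hout, ← χ.tsupport_eq]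
  have hsupp : ∀ y, χ y ≠ 0 → |y - c| ≤ h / 2 := by
    intro y hy
    have h1 : y ∈ Function.support χ := hy
    rw [χ.support_eq, hout, Metric.mem_ball, Real.dist_eq] at h1
    exact h1.le
  have hsub : Icc (c - h / 4) (c + h / 4) ⊆ Ioi 0 := by
    rw [← Real.closedBall_eq_Icc]
    exact (Metric.closedBall_subset_closedBall (by linarith)).trans hball
  have hχint : Integrable (fun y => χ y) :=
    χ.continuous.integrable_of_hasCompactSupport χ.hasCompactSupport
  have hmass : h / 2 ≤ ∫ y in Ioi (0 : ℝ), χ y := by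
    calc h / 2 = ∫ y in Icc (c - h / 4) (c + h / 4), (1 : ℝ) := by
          rw [setIntegral_const, smul_eq_mul, Real.volume_real_Icc_of_le (by linarith)]; ring
      _ = ∫ y in Icc (c - h / 4) (c + h / 4), χ y := by
          refine setIntegral_congr_fun measurableSet_Icc fun y hy => ?_
          rw [← Real.closedBall_eq_Icc, ← hin] at hy
          exact (χ.one_of_mem_closedBall hy).symm
      _ ≤ _ := setIntegral_mono_set hχint.integrableOn
          (Filter.Eventually.of_forall fun x => χ.nonneg) hsub.eventuallyLE
  have hnorm : ‖TestPos.toL2 e‖ ^ 2 ≤ h := by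
    rw [TestPos.norm_toL2_sq]
    have h0 : ∀ y, ‖e y‖ ^ 2 ≤ (Icc (c - h / 2) (c + h / 2)).indicator (fun _ => (1 : ℝ)) y := by
      intro y
      rw [testOfReal_apply, Complex.norm_real, Real.norm_of_nonneg χ.nonneg]
      by_cases hy : χ y = 0
      · rw [hy]; simp only [ne_eq, OfNat.ofNat_ne_zero, not_false_eq_true, zero_pow]
        exact indicator_nonneg (fun _ _ => zero_le_one) _
      · rw [indicator_of_mem]
        · exact pow_le_one₀ χ.nonneg χ.le_one
        · rw [← Real.closedBall_eq_Icc, Metric.mem_closedBall, Real.dist_eq]; exact hsupp y hy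
    have hi : Integrable ((Icc (c - h / 2) (c + h / 2)).indicator (fun _ => (1 : ℝ))) :=
      (integrable_indicator_iff measurableSet_Icc).2 continuous_const.integrableOn_Icc
    calc ∫ x in Ioi (0 : ℝ), ‖e x‖ ^ 2
        ≤ ∫ x in Ioi (0 : ℝ), (Icc (c - h / 2) (c + h / 2)).indicator (fun _ => (1 : ℝ)) x :=
          integral_mono_of_nonneg (Filter.Eventually.of_forall fun x => by positivity)
            hi.integrableOn (Filter.Eventually.of_forall h0)
      _ ≤ ∫ x, (Icc (c - h / 2) (c + h / 2)).indicator (fun _ => (1 : ℝ)) x :=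
          setIntegral_le_integral hi
            (Filter.Eventually.of_forall (indicator_nonneg fun _ _ => zero_le_one))
      _ = h := by
          rw [integral_indicator measurableSet_Icc, setIntegral_const, smul_eq_mul,
            Real.volume_real_Icc_of_le (by linarith)]; ring
  have hlow : ∀ x ∈ Icc (d - h / 2) (d + h / 2),
      u * w * a * (h / 2) ≤ ‖hankelIntegral α β (fun x => (k x : ℂ)) e x‖ := by
    intro x hx
    have hxd : |x - d| ≤ h / 2 := by rw [abs_le]; constructor <;> linarith [hx.1, hx.2]
    have hI : w * a * (h / 2) ≤ ∫ y in Ioi (0 : ℝ), k (x + y) * (y ^ β * χ y) := by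
      calc w * a * (h / 2) ≤ w * a * ∫ y in Ioi (0 : ℝ), χ y := by gcongr
        _ = ∫ y in Ioi (0 : ℝ), w * a * χ y := (integral_const_mul _ _).symm
        _ ≤ _ := by
          refine integral_mono (hχint.integrableOn.const_mul _)
            (integrable_symbol_mul hk χ.contDiff χ.hasCompactSupport hs β x).integrableOn
            fun y => ?_
          by_cases hy : χ y = 0
          · simp [hy]
          · have hyc := hsupp y hy
            have h1 : a ≤ k (x + y) := hka _ (by
              rw [show x + y - (c + d) = (x - d) + (y - c) by ring]
              exact (abs_add_le _ _).trans (by linarith))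
            have h2 := hyβ y hyc
            calc w * a * χ y = a * (w * χ y) := by ring
              _ ≤ _ := mul_le_mul h1 (mul_le_mul_of_nonneg_right h2 χ.nonneg)
                (mul_nonneg hw χ.nonneg) (ha.trans h1)
    have he : (e : ℝ → ℂ) = fun y => (χ y : ℂ) := rfl
    rw [he, hankelIntegral_ofReal, Complex.norm_real]
    refine le_trans ?_ (le_abs_self _)
    calc u * w * a * (h / 2) = u * (w * a * (h / 2)) := by ring
      _ ≤ _ := mul_le_mul (hxα x hxd) hI (by positivity) (hu.trans (hxα x hxd))
  have hm : 0 ≤ u * w * a * (h / 2) := by positivity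
  -- The image is at least `u * w * a * (h / 2)` on an interval of length `h`, and the bump has
  -- squared norm at most `h`, so the two lengths cancel.
  have hTe := hT.sq_mul_le e (by linarith) (by linarith) hm hlow
  rw [show d + h / 2 - (d - h / 2) = h by ring] at hTe
  refine le_of_sq_le_sq ?_ (norm_nonneg _)
  rw [mul_pow]
  exact (mul_le_mul_of_nonneg_left hnorm (by positivity)).trans hTe

theorem toL2_testOfReal_ne_zero {g : ℝ → ℝ} (hg : ContDiff ℝ ∞ g) (hc : HasCompactSupport g)
    (hs : tsupport g ⊆ Ioi 0) {c : ℝ} (h : g c ≠ 0) :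
    TestPos.toL2 (testOfReal g hg hc hs) ≠ 0 := by
  intro h0
  have h1 : (fun x => (g x : ℂ)) =ᵐ[volPos] 0 := by
    have h2 := (TestPos.memLp (testOfReal g hg hc hs)).coeFn_toLp
    rw [TestPos.toL2] at h0
    rw [h0] at h2
    exact h2.symm.trans (Lp.coeFn_zero _ _ _)
  have h2 : (fun x => g x) =ᵐ[volume] fun _ => 0 := by
    rw [Filter.EventuallyEq, ae_restrict_iff' measurableSet_Ioi] at h1
    filter_upwards [h1] with x hx
    by_cases hx0 : x ∈ Ioi (0 : ℝ)
    · simpa using hx hx0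
    · exact image_eq_zero_of_notMem_tsupport fun h => hx0 (hs h)
  have h3 := Continuous.ae_eq_iff_eq volume hg.continuous continuous_const |>.1 h2
  exact h (congrFun h3 c)

theorem inner_toL2_eq_zero {f g : TestPos} (h : ∀ x, f x = 0 ∨ g x = 0) :
    (inner ℂ (TestPos.toL2 f) (TestPos.toL2 g) : ℂ) = 0 := by
  rw [L2.inner_def]
  refine integral_eq_zero_of_ae ?_
  filter_upwards [(TestPos.memLp f).coeFn_toLp, (TestPos.memLp g).coeFn_toLp] with x hf hg
  rw [TestPos.toL2, TestPos.toL2, hf, hg]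
  rcases h x with h | h <;> simp [h]

/-- A family of bumps of width `h` with separated centres `c i`, tested near `d i`, bounds the
Schatten quasinorm of a Hankel operator from below. -/
theorem ExtendsHankel.sum_rpow_le {k : ℝ → ℝ} (hk : Continuous k)
    (hT : ExtendsHankel α β (fun x => (k x : ℂ)) T) {p : ℝ} (hp : 2 ≤ p) (hS : MemSchatten p T)
    {N : ℕ} {c d u w : Fin N → ℝ} {h a : ℝ} (hh : 0 < h) (ha : 0 ≤ a) (hu : ∀ i, 0 ≤ u i)
    (hw : ∀ i, 0 ≤ w i) (hc : ∀ i, h / 2 < c i) (hd : ∀ i, h / 2 < d i)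
    (hcc : ∀ i j, i ≠ j → h ≤ |c i - c j|)
    (hka : ∀ i x, |x - (c i + d i)| ≤ h → a ≤ k x)
    (hyβ : ∀ i y, |y - c i| ≤ h / 2 → w i ≤ y ^ β)
    (hxα : ∀ i x, |x - d i| ≤ h / 2 → u i ≤ x ^ α) :
    ∑ i, (u i * w i * a * (h / 2)) ^ p ≤ ∑' j, singularValue T j ^ p := by
  let χ : ∀ i, ContDiffBump (c i) := fun i => ⟨h / 4, h / 2, by linarith, by linarith⟩
  have hs : ∀ i, tsupport (χ i) ⊆ Ioi 0 := by
    intro i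
    rw [(χ i).tsupport_eq, Real.closedBall_eq_Icc]
    intro x hx
    have h1 : c i - h / 2 ≤ x := hx.1
    have := hc i
    rw [mem_Ioi]; linarith
  let e : Fin N → TestPos := fun i =>
    testOfReal (χ i) (χ i).contDiff (χ i).hasCompactSupport (hs i)
  have he0 : ∀ i, TestPos.toL2 (e i) ≠ 0 := fun i =>
    toL2_testOfReal_ne_zero _ _ _ (c := c i)
      ((χ i).pos_of_mem_ball (Metric.mem_ball_self (χ i).rOut_pos)).ne'
  have horth : Pairwise fun i j => (inner ℂ (TestPos.toL2 (e i)) (TestPos.toL2 (e j)) : ℂ) = 0 := by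
    intro i j hij
    refine inner_toL2_eq_zero fun x => ?_
    by_contra! h0
    have h1 : ∀ i, e i x ≠ 0 → |x - c i| < h / 2 := by
      intro i hi
      have h2 : x ∈ Function.support (χ i) := fun h3 => hi (by
        change ((χ i x : ℝ) : ℂ) = 0
        rw [h3, Complex.ofReal_zero])
      rwa [(χ i).support_eq, Metric.mem_ball, Real.dist_eq] at h2
    have hi := h1 i h0.1
    have hj := h1 j h0.2
    have hij' := hcc i j hij
    have : |c i - c j| ≤ |x - c j| + |x - c i| := by
      rw [show c i - c j = (x - c j) - (x - c i) by ring]; exact abs_sub _ _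
    linarith
  have hon : Orthonormal ℂ fun i => ((‖TestPos.toL2 (e i)‖⁻¹ : ℝ) : ℂ) • TestPos.toL2 (e i) := by
    refine ⟨fun i => ?_, fun i j hij => ?_⟩
    · rw [norm_smul, Complex.norm_real, norm_inv, norm_norm,
        inv_mul_cancel₀ (norm_ne_zero_iff.2 (he0 i))]
    · beta_reduce
      rw [inner_smul_left, inner_smul_right, horth hij, mul_zero, mul_zero]
  refine le_trans (Finset.sum_le_sum fun i _ => ?_)
    (sum_norm_rpow_le_tsum_singularValue hp T hS hon)
  have hpos : 0 < ‖TestPos.toL2 (e i)‖ := norm_pos_iff.2 (he0 i)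
  have := hu i
  have := hw i
  refine Real.rpow_le_rpow (by positivity) ?_ (by linarith)
  rw [map_smul, norm_smul, Complex.norm_real, norm_inv, norm_norm, ← div_eq_inv_mul,
    le_div_iff₀ hpos]
  exact hT.mul_norm_le_of_bump hk ha (hu i) (hw i) (χ i) rfl rfl (hs i) (hd i) (hka i) (hyβ i)
    (hxα i)

end Hankel

/-! ### Exponent at most `-1/2`: no bounded extension -/

section Unbounded

variable {α β : ℝ} {T : L2Pos →L[ℂ] L2Pos}

/-- The weight `x ^ α` with `α ≤ -1/2` forces the range out of `L²`. -/
theorem not_extendsHankel_of_left (hα : α ≤ -1 / 2) {k : ℝ → ℝ}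
    (hk1 : ∀ x, |x - 1| ≤ 1 / 8 → k x = 1) :
    ¬ ExtendsHankel α β (fun x => (k x : ℂ)) T := by
  intro hT
  let χ : ContDiffBump (1 : ℝ) := ⟨1 / 32, 1 / 16, by norm_num, by norm_num⟩
  have hsupp : ∀ y, χ y ≠ 0 → |y - 1| < 1 / 16 := by
    intro y hy
    have h1 : y ∈ Function.support χ := hy
    rwa [χ.support_eq, Metric.mem_ball, Real.dist_eq] at h1
  have hs : tsupport χ ⊆ Ioi 0 := by
    rw [χ.tsupport_eq, Real.closedBall_eq_Icc]
    intro x hx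
    have h1 : 1 - 1 / 16 ≤ x := hx.1
    rw [mem_Ioi]; linarith
  set C := ∫ y in Ioi (0 : ℝ), y ^ β * χ y with hC
  have hcont : Continuous fun y => y ^ β * χ y := (contDiff_rpow_mul β χ.contDiff hs).continuous
  have hint : Integrable fun y => y ^ β * χ y :=
    hcont.integrable_of_hasCompactSupport (χ.hasCompactSupport.mul_left (f := fun y => y ^ β))
  have hCpos : 0 < C := by
    have h0 : 0 ≤ᵐ[volPos] fun y => y ^ β * χ y := by
      filter_upwards [ae_restrict_mem measurableSet_Ioi] with y hy
      exact mul_nonneg (Real.rpow_nonneg (le_of_lt hy) _) χ.nonneg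
    rw [hC, setIntegral_pos_iff_support_of_nonneg_ae h0 hint.integrableOn]
    refine lt_of_lt_of_le (b := volume (Metric.ball (1 : ℝ) (1 / 16))) ?_ (measure_mono ?_)
    · exact Metric.measure_ball_pos _ _ (by norm_num)
    · intro y hy
      have hy0 : 0 < y := hs (by rw [χ.tsupport_eq]; exact Metric.ball_subset_closedBall hy)
      exact ⟨mul_ne_zero (Real.rpow_pos_of_pos hy0 _).ne' (χ.pos_of_mem_ball hy).ne', hy0⟩
  have hval : ∀ x ∈ Ioo (0 : ℝ) (1 / 16),
      ‖hankelIntegral α β (fun x => (k x : ℂ))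
        (testOfReal χ χ.contDiff χ.hasCompactSupport hs) x‖ ^ 2 = C ^ 2 * x ^ (2 * α) := by
    intro x hx
    have he : (testOfReal χ χ.contDiff χ.hasCompactSupport hs : ℝ → ℂ) = fun y => (χ y : ℂ) := rfl
    have hI : ∫ y in Ioi (0 : ℝ), k (x + y) * (y ^ β * χ y) = C := by
      rw [hC]
      congr 1
      ext y
      by_cases hy : χ y = 0
      · simp [hy]
      · have h1 := abs_lt.1 (hsupp y hy)
        rw [hk1 _ (by rw [abs_le]; constructor <;> linarith [h1.1, h1.2, hx.1, hx.2]), one_mul]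
    rw [he, hankelIntegral_ofReal, Complex.norm_real, Real.norm_eq_abs, sq_abs, hI, mul_pow,
      ← Real.rpow_natCast (x ^ α), ← Real.rpow_mul hx.1.le]
    push_cast
    rw [mul_comm α]
    ring
  -- On `(0, 1/16)` the image is exactly `C * x ^ α` with `C > 0`; its square is integrable only if
  -- `2 * α > -1`.
  have h1 := ((hT.integrableOn_norm_sq
    (testOfReal χ χ.contDiff χ.hasCompactSupport hs)).mono_set
    (fun x hx => hx.1 : Ioo (0 : ℝ) (1 / 16) ⊆ Ioi 0)).congr_fun hval measurableSet_Ioo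
  have h2 : IntegrableOn (fun x : ℝ => x ^ (2 * α)) (Ioo 0 (1 / 16)) :=
    (integrable_const_mul_iff (isUnit_iff_ne_zero.2 (by positivity)) _).1 h1
  rw [intervalIntegral.integrableOn_Ioo_rpow_iff (by norm_num)] at h2
  linarith

/-- The weight `y ^ β` with `β ≤ -1/2` makes the operator unbounded. -/
theorem not_extendsHankel_of_right (hβ : β ≤ -1 / 2) {k : ℝ → ℝ}
    (hk1 : ∀ x, |x - 1| ≤ 1 / 8 → k x = 1) :
    ¬ ExtendsHankel α β (fun x => (k x : ℂ)) T := by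
  intro hT
  obtain ⟨u, hu0, hu⟩ : ∃ u : ℝ, 0 < u ∧ ∀ x ∈ Icc (7 / 8 : ℝ) (31 / 32), u ≤ x ^ α := by
    have hc : ContinuousOn (fun x : ℝ => x ^ α) (Icc (7 / 8 : ℝ) (31 / 32)) :=
      fun x hx => (Real.continuousAt_rpow_const x α
        (Or.inl (by have := hx.1; intro h; linarith))).continuousWithinAt
    obtain ⟨z, hz, hmin⟩ := isCompact_Icc.exists_isMinOn ⟨7 / 8, by norm_num, by norm_num⟩ hc
    exact ⟨z ^ α, Real.rpow_pos_of_pos (by linarith [hz.1]) _, fun x hx => hmin hx⟩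
  -- The test function is `y ^ β` cut off to about `[δ, 1/8]`. With `A` its pairing against `y ^ β`,
  -- its squared norm is at most `A` while its image is at least `u * A` on an interval of length
  -- `3/32`. Hence `A` is bounded independently of `δ`, although it dominates `∫ y⁻¹`.
  have key : ∀ δ : ℝ, 0 < δ → δ < 1 / 16 →
      ∫ y in Icc δ (1 / 8), y⁻¹ ≤ ‖T‖ ^ 2 * (32 / 3) / u ^ 2 := by
    intro δ hδ hδ'
    let χ : ContDiffBump ((δ + 1 / 8) / 2) :=
      ⟨(1 / 8 - δ) / 2, 1 / 16, by linarith, by linarith⟩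
    have hsupp : ∀ y, χ y ≠ 0 → y ∈ Ioo (δ / 2) (5 / 32) := by
      intro y hy
      have h1 : y ∈ Function.support χ := hy
      rw [χ.support_eq, Metric.mem_ball, Real.dist_eq, abs_lt] at h1
      have h2 : -(1 / 16) < y - (δ + 1 / 8) / 2 := h1.1
      have h3 : y - (δ + 1 / 8) / 2 < 1 / 16 := h1.2
      constructor <;> linarith
    have hs : tsupport χ ⊆ Ioi 0 := by
      rw [χ.tsupport_eq, Real.closedBall_eq_Icc]
      intro x hx
      have h1 : (δ + 1 / 8) / 2 - 1 / 16 ≤ x := hx.1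
      rw [mem_Ioi]; linarith
    set g : ℝ → ℝ := fun y => y ^ β * χ y with hg
    have hgd : ContDiff ℝ ∞ g := contDiff_rpow_mul β χ.contDiff hs
    have hgc : HasCompactSupport g := χ.hasCompactSupport.mul_left (f := fun y => y ^ β)
    have hgs : tsupport g ⊆ Ioi 0 :=
      (tsupport_mul_subset_right (f := fun y : ℝ => y ^ β) (g := χ)).trans hs
    set A := ∫ y in Ioi (0 : ℝ), y ^ β * g y with hA
    have hint : Integrable fun y => y ^ β * g y :=
      (contDiff_rpow_mul β hgd hgs).continuous.integrable_of_hasCompactSupport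
        (hgc.mul_left (f := fun y => y ^ β))
    have hnn : ∀ y ∈ Ioi (0 : ℝ), 0 ≤ y ^ β * g y := fun y hy => by
      have : 0 ≤ y ^ β := Real.rpow_nonneg (le_of_lt hy) _
      exact mul_nonneg this (mul_nonneg this χ.nonneg)
    have hA0 : 0 ≤ A := setIntegral_nonneg measurableSet_Ioi hnn
    set e := testOfReal g hgd hgc hgs
    have hnorm : ‖TestPos.toL2 e‖ ^ 2 ≤ A := by
      rw [TestPos.norm_toL2_sq]
      refine setIntegral_mono_on ?_ hint.integrableOn measurableSet_Ioi fun y hy => ?_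
      · exact (TestPos.memLp e).integrable_norm_pow two_ne_zero
      · rw [testOfReal_apply, Complex.norm_real, Real.norm_eq_abs, sq_abs]
        have h1 : 0 ≤ y ^ β := Real.rpow_nonneg (le_of_lt hy) _
        calc g y ^ 2 = (y ^ β * y ^ β) * (χ y * χ y) := by rw [hg]; ring
          _ ≤ (y ^ β * y ^ β) * (χ y * 1) := by
            have := χ.nonneg (x := y)
            have := χ.le_one (x := y)
            gcongr
          _ = _ := by rw [hg]; ring
    have hlow : ∀ x ∈ Icc (7 / 8 : ℝ) (31 / 32),
        u * A ≤ ‖hankelIntegral α β (fun x => (k x : ℂ)) e x‖ := by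
      intro x hx
      have he : (e : ℝ → ℂ) = fun y => (g y : ℂ) := rfl
      have hI : ∫ y in Ioi (0 : ℝ), k (x + y) * (y ^ β * g y) = A := by
        rw [hA]
        congr 1
        ext y
        by_cases hy : χ y = 0
        · simp [hg, hy]
        · have h1 := hsupp y hy
          rw [hk1 _ (by rw [abs_le]; constructor <;> linarith [h1.1, h1.2, hx.1, hx.2]), one_mul]
      rw [he, hankelIntegral_ofReal, Complex.norm_real, hI]
      exact (mul_le_mul_of_nonneg_right (hu x hx) hA0).trans (le_abs_self _)
    have h1 := hT.sq_mul_le e (by norm_num) (by norm_num) (by positivity) hlow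
    have h2 : ‖T (TestPos.toL2 e)‖ ^ 2 ≤ ‖T‖ ^ 2 * A := by
      calc _ ≤ (‖T‖ * ‖TestPos.toL2 e‖) ^ 2 := by gcongr; exact T.le_opNorm _
        _ = ‖T‖ ^ 2 * ‖TestPos.toL2 e‖ ^ 2 := mul_pow _ _ _
        _ ≤ _ := by gcongr
    have hlog : ∫ y in Icc δ (1 / 8), y⁻¹ ≤ A := by
      have hsub : Icc δ (1 / 8) ⊆ Ioi 0 := fun y hy => hδ.trans_le hy.1
      calc ∫ y in Icc δ (1 / 8), y⁻¹ ≤ ∫ y in Icc δ (1 / 8), y ^ β * g y := by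
            refine setIntegral_mono_on ?_ hint.integrableOn measurableSet_Icc fun y hy => ?_
            · exact (continuousOn_inv₀.mono fun y hy => (hsub hy).ne').integrableOn_Icc
            · have hy0 : 0 < y := hsub hy
              have h3 : χ y = 1 := by
                apply χ.one_of_mem_closedBall
                rw [Metric.mem_closedBall, Real.dist_eq, abs_le]
                change -((1 / 8 - δ) / 2) ≤ _ ∧ _ ≤ (1 / 8 - δ) / 2
                constructor <;> linarith [hy.1, hy.2]
              rw [hg]
              simp only [h3, mul_one]
              rw [← Real.rpow_add hy0, ← Real.rpow_neg_one]
              exact Real.rpow_le_rpow_of_exponent_ge hy0 (by linarith [hy.2]) (by linarith)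
        _ ≤ _ := setIntegral_mono_set hint.integrableOn
          ((ae_restrict_mem measurableSet_Ioi).mono hnn) hsub.eventuallyLE
    refine hlog.trans ?_
    rw [le_div_iff₀ (by positivity)]
    rcases hA0.eq_or_lt with h0 | h0
    · rw [← h0, zero_mul]; positivity
    · have h3 : A * (A * u ^ 2) ≤ A * (‖T‖ ^ 2 * (32 / 3)) := by nlinarith [h1.trans h2]
      exact le_of_mul_le_mul_left h3 h0
  set C := ‖T‖ ^ 2 * (32 / 3) / u ^ 2
  have hC : 0 ≤ C := by positivity
  have hexp : Real.exp (-(C + 1)) < 1 / 2 := by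
    calc Real.exp (-(C + 1)) ≤ Real.exp (-1) := Real.exp_le_exp.2 (by linarith)
      _ < 1 / 2 := by linarith [Real.exp_neg_one_lt_d9]
  have hexp0 := Real.exp_pos (-(C + 1))
  -- This `δ` makes the logarithmic integral equal to `C + 1`.
  have h := key (Real.exp (-(C + 1)) / 8) (by positivity) (by linarith)
  rw [integral_Icc_eq_integral_Ioc, ← intervalIntegral.integral_of_le (by linarith),
    integral_inv_of_pos (by positivity) (by norm_num)] at h
  rw [show (1 / 8 : ℝ) / (Real.exp (-(C + 1)) / 8) = (Real.exp (-(C + 1)))⁻¹ by field_simp,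
    Real.log_inv, Real.log_exp] at h
  linarith

end Unbounded

/-! ### Exponent at most `-1/p`: the harmonic gain of one spike -/

section Spikes

/-- For `0 < x` between `R / 2` and `R`, powers of `x` are comparable to those of `R`. -/
theorem rpow_ge_of_mem_Icc {R x : ℝ} (hR : 0 < R) (hx : x ∈ Icc (R / 2) R) (α : ℝ) :
    (2 : ℝ) ^ (-|α|) * R ^ α ≤ x ^ α := by
  have hx0 : 0 < x := by linarith [hx.1]
  rcases le_total 0 α with h | h
  · rw [abs_of_nonneg h]
    calc (2 : ℝ) ^ (-α) * R ^ α = (R / 2) ^ α := by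
          rw [Real.div_rpow hR.le zero_le_two, Real.rpow_neg zero_le_two]; ring
      _ ≤ x ^ α := Real.rpow_le_rpow (by positivity) hx.1 h
  · rw [abs_of_nonpos h, neg_neg]
    calc (2 : ℝ) ^ α * R ^ α ≤ 1 * R ^ α := by
          gcongr
          exact Real.rpow_le_one_of_one_le_of_nonpos one_le_two h
      _ ≤ x ^ α := by
          rw [one_mul]; exact Real.rpow_le_rpow_of_nonpos hx0 hx.2 h

/-- Reduces any admissible exponent to the borderline `-1/p`, whose `p`-th power is the harmonic
weight `1 / z`; the excess exponent is nonpositive, so it is smallest at `R`. -/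
theorem rpow_ge_of_le_neg_one_div {p β R y z : ℝ} (hp : 0 < p) (hβ : β ≤ -1 / p) (hz : z ≤ R)
    (hy : 0 < y) (hyz : y ≤ z) : R ^ (β + 1 / p) * z ^ (-1 / p) ≤ y ^ β := by
  have hz0 : 0 < z := hy.trans_le hyz
  have hβ0 : β ≤ 0 := hβ.trans (div_nonpos_of_nonpos_of_nonneg (by norm_num) hp.le)
  have hβp : β + 1 / p ≤ 0 := by
    rw [neg_div] at hβ
    linarith
  calc R ^ (β + 1 / p) * z ^ (-1 / p) ≤ z ^ (β + 1 / p) * z ^ (-1 / p) := by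
        exact mul_le_mul_of_nonneg_right (Real.rpow_le_rpow_of_nonpos hz0 hz hβp)
          (Real.rpow_nonneg hz0.le _)
    _ = z ^ β := by rw [← Real.rpow_add hz0]; congr 1; ring
    _ ≤ y ^ β := Real.rpow_le_rpow_of_nonpos hy hyz hβ0

theorem exists_sum_one_div_ge (M : ℝ) : ∃ N : ℕ, M ≤ ∑ i : Fin N, 1 / ((i : ℝ) + 2) := by
  obtain ⟨N, hN⟩ := (Real.tendsto_sum_range_one_div_nat_succ_atTop.eventually_ge_atTop
    (2 * M)).exists
  refine ⟨N, ?_⟩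
  rw [← Finset.sum_range (fun i : ℕ => 1 / ((i : ℝ) + 2))]
  have h : ∑ i ∈ Finset.range N, 1 / 2 * (1 / ((i : ℝ) + 1))
      ≤ ∑ i ∈ Finset.range N, 1 / ((i : ℝ) + 2) := by
    refine Finset.sum_le_sum fun i _ => ?_
    rw [one_div_mul_one_div, div_le_div_iff_of_pos_left one_pos (by positivity) (by positivity)]
    linarith [(Nat.cast_nonneg i : (0 : ℝ) ≤ i)]
  rw [← Finset.mul_sum] at h
  linarith

variable {α β : ℝ} {T : L2Pos →L[ℂ] L2Pos}

/-- A symbol that is at least `a` on `[R, R + 2 h]`, with `h = R / (8 (N + 1))`, gives a Hankel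
operator whose Schatten quasinorm grows logarithmically in `N`, provided that one of the weights
has exponent at most `-1 / p`. -/
theorem ExtendsHankel.spike_le {k : ℝ → ℝ} (hk : Continuous k)
    (hT : ExtendsHankel α β (fun x => (k x : ℂ)) T) {p : ℝ} (hp : 2 ≤ p) (hS : MemSchatten p T)
    (hαβ : min α β ≤ -1 / p) {R a : ℝ} (hR : 0 < R) (ha : 0 ≤ a) {N : ℕ} {h : ℝ}
    (hh : h = R / (8 * (N + 1))) (hka : ∀ x, |x - (R + h)| ≤ h → a ≤ k x) :
    (2 : ℝ) ^ (-((|α| + |β|) * p + p)) * (a ^ p * h ^ (p - 1) * R ^ ((1 / p + α + β) * p)) *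
      ∑ i : Fin N, 1 / ((i : ℝ) + 2) ≤ ∑' j, singularValue T j ^ p := by
  have hp0 : 0 < p := by linarith
  have hh0 : 0 < h := by rw [hh]; positivity
  have hNR : (N + 1) * h = R / 8 := by rw [hh]; field_simp
  have hi1 : ∀ i : Fin N, ((i : ℝ) + 2) * h ≤ R / 8 := by
    intro i
    rw [← hNR]
    have : ((i : ℕ) : ℝ) + 1 ≤ N := by exact_mod_cast i.2
    gcongr ?_ * h
    linarith
  have hi0 : ∀ i : Fin N, 0 ≤ (i : ℝ) * h := fun i => by positivity
  -- Bump `i` occupies `[(i + 1) * h, (i + 2) * h]`. The offset `3/2` keeps the reflected intervals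
  -- around `d i` below `R`, and `(N + 1) * h = R / 8` keeps them above `R / 2`.
  set c : Fin N → ℝ := fun i => ((i : ℝ) + 3 / 2) * h with hc
  set d : Fin N → ℝ := fun i => R + h - c i with hd
  have hcd : ∀ i, c i + d i = R + h := fun i => by rw [hd]; ring
  have hch : ∀ i, h / 2 < c i := fun i => by
    have := hi0 i
    rw [hc]; linarith
  have hdh : ∀ i, h / 2 < d i := fun i => by
    have := hi1 i
    rw [hd, hc]; linarith
  have hsep : ∀ i j : Fin N, i ≠ j → h ≤ |c i - c j| := by
    intro i j hij
    have h1 : (1 : ℝ) ≤ |((i : ℕ) : ℝ) - ((j : ℕ) : ℝ)| := by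
      have : (1 : ℤ) ≤ |((i : ℕ) : ℤ) - ((j : ℕ) : ℤ)| :=
        Int.one_le_abs (sub_ne_zero.2 fun h => hij (Fin.ext (by exact_mod_cast h)))
      exact_mod_cast this
    rw [show c i - c j = (((i : ℕ) : ℝ) - ((j : ℕ) : ℝ)) * h by rw [hc]; ring, abs_mul,
      abs_of_pos hh0]
    nlinarith
  have hsep' : ∀ i j : Fin N, i ≠ j → h ≤ |d i - d j| := by
    intro i j hij
    rw [show d i - d j = c j - c i by rw [hd]; ring]
    exact hsep j i hij.symm
  have hsmall : ∀ γ : ℝ, γ ≤ -1 / p → ∀ i : Fin N, ∀ y, |y - c i| ≤ h / 2 →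
      R ^ (γ + 1 / p) * (((i : ℝ) + 2) * h) ^ (-1 / p) ≤ y ^ γ := by
    intro γ hγ i y hy
    rw [abs_le, hc] at hy
    have := hi0 i
    have := hi1 i
    exact rpow_ge_of_le_neg_one_div hp0 hγ (by linarith) (by linarith [hy.1]) (by linarith [hy.2])
  have hlarge : ∀ γ : ℝ, ∀ i : Fin N, ∀ x, |x - d i| ≤ h / 2 →
      (2 : ℝ) ^ (-|γ|) * R ^ γ ≤ x ^ γ := by
    intro γ i x hx
    rw [abs_le, hd, hc] at hx
    have := hi0 i
    have := hi1 i
    exact rpow_ge_of_mem_Icc hR ⟨by linarith [hx.1], by linarith [hx.2]⟩ γ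
  -- Here `γ` is the exponent of the variable near `R` and `δ` that of the small one. The factor `h
  -- ^ p` from the box and `h⁻¹` from the weight combine to the Besov power `h ^ (p - 1)`.
  have hcalc : ∀ γ δ : ℝ, ∀ i : Fin N,
      (2 : ℝ) ^ (-((|γ| + |δ|) * p + p)) * (a ^ p * h ^ (p - 1) * R ^ ((1 / p + γ + δ) * p)) *
        (1 / ((i : ℝ) + 2)) ≤
      ((2 : ℝ) ^ (-|γ|) * R ^ γ * (R ^ (δ + 1 / p) * (((i : ℝ) + 2) * h) ^ (-1 / p)) * a *
        (h / 2)) ^ p := by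
    intro γ δ i
    have h2 : (0 : ℝ) < (i : ℝ) + 2 := by positivity
    have e1 : ((((i : ℝ) + 2) * h) ^ (-1 / p)) ^ p = 1 / ((i : ℝ) + 2) * h ^ (-1 : ℝ) := by
      rw [← Real.rpow_mul (by positivity), div_mul_cancel₀ _ hp0.ne', Real.mul_rpow h2.le hh0.le,
        Real.rpow_neg_one, one_div]
    have e2 : (R ^ γ) ^ p * (R ^ (δ + 1 / p)) ^ p = R ^ ((1 / p + γ + δ) * p) := by
      rw [← Real.rpow_mul hR.le, ← Real.rpow_mul hR.le, ← Real.rpow_add hR]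
      congr 1; ring
    have e3 : h ^ (-1 : ℝ) * h ^ p = h ^ (p - 1) := by
      rw [← Real.rpow_add hh0]; congr 1; ring
    have e4 : (h / 2) ^ p = h ^ p * 2 ^ (-p) := by
      rw [Real.div_rpow hh0.le zero_le_two, Real.rpow_neg zero_le_two]; rfl
    have e5 : (2 : ℝ) ^ (-((|γ| + |δ|) * p + p)) ≤ ((2 : ℝ) ^ (-|γ|)) ^ p * 2 ^ (-p) := by
      rw [← Real.rpow_mul zero_le_two, ← Real.rpow_add two_pos]
      apply Real.rpow_le_rpow_of_exponent_le one_le_two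
      nlinarith [mul_nonneg (abs_nonneg δ) hp0.le]
    rw [Real.mul_rpow (by positivity) (by positivity), Real.mul_rpow (by positivity) ha,
      Real.mul_rpow (by positivity) (by positivity), Real.mul_rpow (by positivity) (by positivity),
      Real.mul_rpow (by positivity) (by positivity), e1, e4]
    calc _ ≤ (((2 : ℝ) ^ (-|γ|)) ^ p * 2 ^ (-p)) *
          (a ^ p * h ^ (p - 1) * R ^ ((1 / p + γ + δ) * p)) * (1 / ((i : ℝ) + 2)) := by gcongr
      _ = _ := by rw [← e2, ← e3]; ring
  rw [Finset.mul_sum]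
  rcases min_le_iff.1 hαβ with hα | hβ
  -- When `α` is the small exponent, the test bumps sit near `R` and the images are measured near
  -- `0`.
  · refine le_trans (Finset.sum_le_sum fun i _ => ?_)
      (hT.sum_rpow_le hk hp hS (c := d) (d := c)
        (u := fun i => R ^ (α + 1 / p) * (((i : ℝ) + 2) * h) ^ (-1 / p))
        (w := fun _ => (2 : ℝ) ^ (-|β|) * R ^ β) hh0 ha (fun i => by positivity)
        (fun i => by positivity) hdh hch hsep'
        (fun i x hx => hka x (by rwa [add_comm (d i), hcd] at hx)) (hlarge β) (hsmall α hα))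
    have := hcalc β α i
    rw [add_comm |α|, add_right_comm (1 / p) α β,
      mul_comm (R ^ (α + 1 / p) * _) ((2 : ℝ) ^ (-|β|) * R ^ β)]
    exact this
  · refine le_trans (Finset.sum_le_sum fun i _ => ?_)
      (hT.sum_rpow_le hk hp hS (c := c) (d := d)
        (u := fun _ => (2 : ℝ) ^ (-|α|) * R ^ α)
        (w := fun i => R ^ (β + 1 / p) * (((i : ℝ) + 2) * h) ^ (-1 / p)) hh0 ha
        (fun i => by positivity)
        (fun i => by positivity) hch hdh hsep
        (fun i x hx => hka x (by rwa [hcd] at hx)) (hsmall β hβ) (hlarge α))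
    exact hcalc α β i

end Spikes

/-! ### The two counterexamples and their combination -/

theorem exists_not_hankelMemSchatten_of_le_neg_half {v : ℝ → ℂ} (hv : IsDyadicCutoff v)
    {α β p : ℝ} (hp : 0 < p) (s : ℝ) (hαβ : min α β ≤ -1 / 2) :
    ∃ ψ : ℝ → ℂ, MemBesov v p s ψ ∧ ¬ HankelMemSchatten α β p ψ := by
  let χ : ContDiffBump (1 : ℝ) := ⟨1 / 8, 1 / 4, by norm_num, by norm_num⟩
  have h1 : ∀ x, |x - 1| ≤ 1 / 8 → χ x = 1 := fun x hx =>
    χ.one_of_mem_closedBall (by rwa [Metric.mem_closedBall, Real.dist_eq])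
  refine ⟨fun x => (χ x : ℂ), hv.memBesov_of_contDiff hp s
    (Complex.ofRealCLM.contDiff.comp χ.contDiff)
    (χ.hasCompactSupport.comp_left (g := fun r : ℝ => (r : ℂ)) Complex.ofReal_zero)
    (k := 0) ?_, ?_⟩
  · intro x hx
    have h2 : x ∈ Function.support χ := fun h => hx (by
      change ((χ x : ℝ) : ℂ) = 0
      rw [h, Complex.ofReal_zero])
    rw [χ.support_eq, Metric.mem_ball, Real.dist_eq, abs_lt] at h2
    have h3 : -(1 / 4) < x - 1 := h2.1
    have h4 : x - 1 < 1 / 4 := h2.2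
    rw [zpow_zero]
    constructor <;> linarith
  · rintro ⟨T, hT, -⟩
    rcases min_le_iff.1 hαβ with h | h
    · exact not_extendsHankel_of_left h h1 hT
    · exact not_extendsHankel_of_right h h1 hT

theorem exists_not_hankelMemSchatten_of_le_neg_one_div {v : ℝ → ℂ} (hv : IsDyadicCutoff v)
    {α β p : ℝ} (hp : 2 ≤ p) (hαβ : min α β ≤ -1 / p) :
    ∃ ψ : ℝ → ℂ, MemBesov v p (1 / p + α + β) ψ ∧ ¬ HankelMemSchatten α β p ψ := by
  have hp0 : 0 < p := by linarith
  set s := 1 / p + α + β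
  -- The factor `2 ^ n` undoes the Besov weight `(1 / 2) ^ n` of the spike; the extra `n` makes the
  -- Schatten bounds unbounded.
  choose N hN using fun n : ℕ => exists_sum_one_div_ge ((2 : ℝ) ^ n * n)
  let R : ℕ → ℝ := fun n => 8 ^ n
  have hR : ∀ n, 0 < R n := fun n => by positivity
  let h : ℕ → ℝ := fun n => R n / (8 * (N n + 1))
  have hh : ∀ n, 0 < h n := fun n => by have := hR n; positivity
  have hhR : ∀ n, h n ≤ R n / 8 := fun n => by
    have := hR n
    have : (0 : ℝ) ≤ N n := Nat.cast_nonneg _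
    apply div_le_div_of_nonneg_left (hR n).le (by norm_num)
    linarith
  -- The height is chosen so that the spike has Besov size exactly `(1 / 2) ^ n`, up to constants.
  let a : ℕ → ℝ := fun n => ((1 / 2) ^ n / (h n ^ (p - 1) * R n ^ (s * p))) ^ (1 / p)
  have hq : ∀ n, 0 < h n ^ (p - 1) * R n ^ (s * p) := fun n =>
    mul_pos (Real.rpow_pos_of_pos (hh n) _) (Real.rpow_pos_of_pos (hR n) _)
  have ha : ∀ n, 0 ≤ a n := fun n =>
    Real.rpow_nonneg (div_nonneg (by positivity) (hq n).le) _
  have hab : ∀ n, a n ^ p * h n ^ (p - 1) * R n ^ (s * p) = (1 / 2) ^ n := by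
    intro n
    rw [← Real.rpow_mul (div_nonneg (by positivity) (hq n).le), one_div_mul_cancel hp0.ne',
      Real.rpow_one, mul_assoc, div_mul_cancel₀ _ (hq n).ne']
  let χ : ∀ n, ContDiffBump (R n + h n) := fun n =>
    ⟨h n, 2 * h n, hh n, by linarith [hh n]⟩
  let φ : ℕ → ℝ → ℂ := fun n x => ((a n * χ n x : ℝ) : ℂ)
  let k : ℝ → ℝ := fun x => ∑ᶠ n, a n * χ n x
  have hψk : (fun x => ∑ᶠ n, φ n x) = fun x => (k x : ℂ) := by
    ext x
    exact (AddMonoidHom.map_finsum_of_injective Complex.ofRealHom.toAddMonoidHom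
      Complex.ofReal_injective fun n => a n * χ n x).symm
  have hsuppχ : ∀ n x, χ n x ≠ 0 → x ∈ Metric.ball (R n + h n) (2 * h n) := by
    intro n x hx
    have h1 : x ∈ Function.support (χ n) := hx
    rwa [(χ n).support_eq] at h1
  have hsuppI : ∀ n x, χ n x ≠ 0 → x ∈ Ioo (R n / 2) (R n * 2) := by
    intro n x hx
    have h1 := hsuppχ n x hx
    rw [Metric.mem_ball, Real.dist_eq, abs_lt] at h1
    have := hhR n
    have := hR n
    constructor <;> linarith [h1.1, h1.2]
  have hφχ : ∀ n x, φ n x ≠ 0 → χ n x ≠ 0 := by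
    intro n x hx h0
    apply hx
    change ((a n * χ n x : ℝ) : ℂ) = 0
    rw [h0, mul_zero, Complex.ofReal_zero]
  have hlf : LocallyFinite fun n => Function.support fun x => a n * χ n x :=
    locallyFinite_of_subset_Ioo fun n x hx => hsuppI n x (right_ne_zero_of_mul hx)
  have hk : Continuous k :=
    continuous_finsum (fun n => continuous_const.mul (χ n).continuous) hlf
  -- All spikes are nonnegative, so the whole symbol dominates each one and no spike needs to be
  -- isolated from the others.
  have hka : ∀ n x, |x - (R n + h n)| ≤ h n → a n ≤ k x := by
    intro n x hx
    have h1 : χ n x = 1 :=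
      (χ n).one_of_mem_closedBall (by rwa [Metric.mem_closedBall, Real.dist_eq])
    calc a n = a n * χ n x := by rw [h1, mul_one]
      _ ≤ k x := single_le_finsum (f := fun n => a n * χ n x) n (hlf.point_finite x)
        fun m => mul_nonneg (ha m) (χ m).nonneg
  refine ⟨fun x => ∑ᶠ n, φ n x, hv.memBesov_finsum hp s φ (fun n => R n + h n)
    (fun n => 2 * h n) a (fun n => 2 ^ (p - 1) * (1 / 2) ^ n)
    (fun n => Complex.ofRealCLM.contDiff.comp (contDiff_const.mul (χ n).contDiff))
    (fun n => by linarith [hh n]) ha (fun n x => ?_)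
    (fun n x hx => hsuppχ n x (hφχ n x hx)) (fun n x hx => hsuppI n x (hφχ n x hx))
    (summable_geometric_two.mul_left _) (fun n => ?_), ?_⟩
  · rw [Complex.norm_real, Real.norm_of_nonneg (mul_nonneg (ha n) (χ n).nonneg)]
    exact mul_le_of_le_one_right (ha n) (χ n).le_one
  · rw [← hab n, Real.mul_rpow zero_le_two (hh n).le]
    exact le_of_eq (by ring)
  · rw [hψk]
    rintro ⟨T, hT, hS⟩
    set c := (2 : ℝ) ^ (-((|α| + |β|) * p + p)) with hc
    have hc0 : 0 < c := Real.rpow_pos_of_pos two_pos _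
    have hbound : ∀ n : ℕ, c * n ≤ ∑' j, singularValue T j ^ p := by
      intro n
      refine le_trans ?_ (hT.spike_le hk hp hS hαβ (hR n) (ha n) rfl (hka n))
      rw [hab n, mul_assoc]
      gcongr
      calc (n : ℝ) = (1 / 2) ^ n * (2 ^ n * n) := by
            rw [← mul_assoc, ← mul_pow]; norm_num
        _ ≤ _ := by gcongr; exact hN n
    obtain ⟨n, hn⟩ := exists_nat_gt ((∑' j, singularValue T j ^ p) / c)
    rw [div_lt_iff₀ hc0, mul_comm] at hn
    exact absurd (hbound n) (not_le.2 hn)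

end WeightedHankel

end

theorem theorem3p1 (v : ℝ → ℂ) (hv : WeightedHankel.IsDyadicCutoff v)
    (α β p : ℝ) (hp : 0 < p) (hαβ : min α β ≤ max (-1 / 2) (-1 / p)) :
    ∃ ψ : ℝ → ℂ, WeightedHankel.MemBesov v p (1 / p + α + β) ψ ∧
      ¬ WeightedHankel.HankelMemSchatten α β p ψ := by
  by_cases h : min α β ≤ -1 / 2
  · exact WeightedHankel.exists_not_hankelMemSchatten_of_le_neg_half hv hp _ h
  · have h1 : min α β ≤ -1 / p := (le_max_iff.1 hαβ).resolve_left h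
    -- For `p < 2` one has `-1/p < -1/2`, which the first case already covers.
    refine WeightedHankel.exists_not_hankelMemSchatten_of_le_neg_one_div hv ?_ h1
    by_contra hp2
    refine h (h1.trans ?_)
    rw [div_le_div_iff₀ hp two_pos]
    linarith
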